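/- Let $F(a,b)$ be the free group on $a,b$. For $w\in F(a,b)$ let $f_w\in\mathbb Z[x,y,z]$ be its Fricke trace polynomial, i.e. the unique polynomial such that $\operatorname{Tr}(w(A,B))=f_w(\operatorname{Tr}A,\operatorname{Tr}B,\operatorname{Tr}(AB))$ for all $A,B\in\operatorname{SL}(2,\mathbb C)$. Let $\deg$ denote total degree, and let $[f]_{\rm top}$ be the homogeneous part of $f\neq 0$ of degree $\deg f$. Let $w=u_1\cdots u_n$ be a nontrivial cyclically reduced word over $\{a,a^{-1},b,b^{-1}\}$ (so $n\ge 1$). For letters $r,s$ let $N_{rs}$ be the number of $i\in\{1,\dots,n\}$ with $u_i=r$ and $u_{i+1}=s$, indices being read modulo $n$. Put $m_a=\#\{i:u_i\in\{a,a^{-1}\}\}$, $m_b=\#\{i:u_i\in\{b,b^{-1}\}\}$ and $R=N_{ab}+N_{b^{-1}a^{-1}}$. Then: (1) $R\le m_a$, $R\le m_b$, and $$[f_w]_{\rm top}=(-1)^{N_{ab}+N_{ba}}\,x^{m_a-R}\,y^{m_b-R}\,z^{R}.$$ In particular, $$\deg f_w=n-R=n-\tfrac12\bigl(N_{ab}+N_{ba}+N_{a^{-1}b^{-1}}+N_{b^{-1}a^{-1}}\bigr).$$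 (2) Consequently $\lceil n/2\rceil\le\deg f_w\le n$. Moreover, for every $n\ge1$ there is a cyclically reduced word of length $n$ with $\deg f_w=\lceil n/2\rceil$, and there is a cyclically reduced word of length $n$ with $\deg f_w=n$. -/

import Mathlib

namespace Fricke

open Matrix

/-- The group `SL(2, ℂ)`. -/
abbrev SL2C : Type := Matrix.SpecialLinearGroup (Fin 2) ℂ

/-- The letters `a, a⁻¹, b, b⁻¹`, in Mathlib's encoding of words for the free group
`F(a, b) = FreeGroup (Fin 2)`: the first component is the generator (`0` for `a`, `1` for `b`), the
second one is `true` for the generator and `false` for its inverse. -/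
abbrev Letter : Type := Fin 2 × Bool

/-- The letter `a`. -/
abbrev letA : Letter := (0, true)
/-- The letter `a⁻¹`. -/
abbrev letAinv : Letter := (0, false)
/-- The letter `b`. -/
abbrev letB : Letter := (1, true)
/-- The letter `b⁻¹`. -/
abbrev letBinv : Letter := (1, false)

/-- The element `w(A, B)` of `SL(2, ℂ)`, for `w ∈ F(a, b)`. -/
def evalWord (A B : SL2C) (w : FreeGroup (Fin 2)) : SL2C := FreeGroup.lift ![A, B] w

/-- The trace of an element of `SL(2, ℂ)`. -/
def tr (A : SL2C) : ℂ := Matrix.trace (A : Matrix (Fin 2) (Fin 2) ℂ)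

/-- `f(x, y, z) ∈ ℤ[x, y, z]` is a trace polynomial of `w` if
`Tr w(A, B) = f(Tr A, Tr B, Tr AB)` for all `A, B ∈ SL(2, ℂ)`.  The variables `x, y, z` are
`X 0, X 1, X 2`. -/
def IsTracePolynomial (w : FreeGroup (Fin 2)) (f : MvPolynomial (Fin 3) ℤ) : Prop :=
  ∀ A B : SL2C, tr (evalWord A B w) = MvPolynomial.aeval ![tr A, tr B, tr (A * B)] f

section Existence

theorem mul_self_eq (A : SL2C) : (A : Matrix (Fin 2) (Fin 2) ℂ) * A = tr A • A.1 - 1 := by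
  have h := A.2
  rw [Matrix.det_fin_two] at h
  ext i j
  fin_cases i <;> fin_cases j <;>
    simp [tr, Matrix.mul_apply, Fin.sum_univ_two, Matrix.trace_fin_two] <;>
      first | ring1 | linear_combination -h

theorem mul_comm_eq (A B : SL2C) : (B : Matrix (Fin 2) (Fin 2) ℂ) * A =
    tr A • B.1 + tr B • A.1 + (tr (A * B) - tr A * tr B) • (1 : Matrix (Fin 2) (Fin 2) ℂ)
      - A.1 * B.1 := by
  ext i j
  fin_cases i <;> fin_cases j <;>
    simp [tr, Matrix.mul_apply, Fin.sum_univ_two, Matrix.trace_fin_two] <;> ring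

theorem inv_eq (A : SL2C) :
    ((A⁻¹ : SL2C) : Matrix (Fin 2) (Fin 2) ℂ) = tr A • (1 : Matrix (Fin 2) (Fin 2) ℂ) - A.1 := by
  ext i j
  fin_cases i <;> fin_cases j <;>
    simp [tr, Matrix.adjugate_fin_two, Matrix.trace_fin_two]

/-- Every `w(A, B)` is a combination of `1, A, B, AB` with coefficients in `ℤ[x, y, z]`. -/
theorem exists_combination (L : List Letter) : ∃ p q r s : MvPolynomial (Fin 3) ℤ,
    ∀ A B : SL2C, (evalWord A B (FreeGroup.mk L)).1 =
      MvPolynomial.aeval ![tr A, tr B, tr (A * B)] p • (1 : Matrix (Fin 2) (Fin 2) ℂ)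
      + MvPolynomial.aeval ![tr A, tr B, tr (A * B)] q • A.1
      + MvPolynomial.aeval ![tr A, tr B, tr (A * B)] r • B.1
      + MvPolynomial.aeval ![tr A, tr B, tr (A * B)] s • (A.1 * B.1) := by
  induction L with
  | nil =>
    refine ⟨1, 0, 0, 0, fun A B => ?_⟩
    simp [evalWord, ← FreeGroup.one_eq_mk]
  | cons c L ih =>
    obtain ⟨p, q, r, s, h⟩ := ih
    have key : ∀ A B : SL2C, (evalWord A B (FreeGroup.mk (c :: L))).1 =
        (cond c.2 (![A, B] c.1) (![A, B] c.1)⁻¹ : SL2C).1 *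
          (evalWord A B (FreeGroup.mk L)).1 := by
      intro A B
      simp [evalWord, FreeGroup.lift_mk]
    have hAA : ∀ A M : SL2C, A.1 * (A.1 * M.1) = tr A • (A.1 * M.1) - M.1 := by
      intro A M
      rw [← mul_assoc, mul_self_eq, sub_mul, one_mul, smul_mul_assoc]
    have hBAB : ∀ A B : SL2C, B.1 * (A.1 * B.1) =
        A.1 - tr A • (1 : Matrix (Fin 2) (Fin 2) ℂ) + tr (A * B) • B.1 := by
      intro A B
      rw [← mul_assoc, mul_comm_eq]
      simp only [add_mul, sub_mul, smul_mul_assoc, one_mul, mul_assoc, mul_self_eq B, mul_sub,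
        mul_one, mul_smul_comm]
      module
    obtain ⟨i, e⟩ := c
    fin_cases i <;> cases e
    · refine ⟨MvPolynomial.X 0 * p + q, -p, MvPolynomial.X 0 * r + s, -r, fun A B => ?_⟩
      rw [key, h]
      simp only [Fin.zero_eta, Matrix.cons_val_zero, cond_false, inv_eq, sub_mul, mul_add,
        smul_mul_assoc, mul_smul_comm, one_mul, mul_one, mul_self_eq A, hAA, map_add, map_mul,
        map_neg, MvPolynomial.aeval_X]
      module
    · refine ⟨-q, p + MvPolynomial.X 0 * q, -s, r + MvPolynomial.X 0 * s, fun A B => ?_⟩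
      rw [key, h]
      simp only [Fin.zero_eta, Matrix.cons_val_zero, cond_true, mul_add,
        mul_smul_comm, mul_one, mul_self_eq A, hAA, map_add, map_mul,
        map_neg, MvPolynomial.aeval_X]
      module
    · refine ⟨MvPolynomial.X 1 * p
          - (MvPolynomial.X 2 - MvPolynomial.X 0 * MvPolynomial.X 1) * q + r
          + MvPolynomial.X 0 * s,
        -s, -p - MvPolynomial.X 0 * q - MvPolynomial.X 2 * s, q + MvPolynomial.X 1 * s, fun A B => ?_⟩
      rw [key, h]
      simp only [Fin.mk_one, Matrix.cons_val_one, Matrix.cons_val_zero, cond_false, inv_eq, sub_mul,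
        mul_add, smul_mul_assoc, mul_smul_comm, one_mul, mul_one, mul_self_eq B, mul_comm_eq A B,
        hBAB, map_add, map_sub, map_mul, map_neg, MvPolynomial.aeval_X, Matrix.cons_val]
      module
    · refine ⟨(MvPolynomial.X 2 - MvPolynomial.X 0 * MvPolynomial.X 1) * q - r
          - MvPolynomial.X 0 * s,
        MvPolynomial.X 1 * q + s,
        p + MvPolynomial.X 0 * q + MvPolynomial.X 1 * r + MvPolynomial.X 2 * s, -q, fun A B => ?_⟩
      rw [key, h]
      simp only [Fin.mk_one, Matrix.cons_val_one, Matrix.cons_val_zero, cond_true,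
        mul_add, mul_smul_comm, mul_one, mul_self_eq B, mul_comm_eq A B,
        hBAB, map_add, map_sub, map_mul, map_neg, MvPolynomial.aeval_X, Matrix.cons_val]
      module

/-- Every triple of complex numbers is `(Tr A, Tr B, Tr AB)` for some `A, B ∈ SL(2, ℂ)`. -/
theorem exists_traces (x y z : ℂ) : ∃ A B : SL2C, tr A = x ∧ tr B = y ∧ tr (A * B) = z := by
  obtain ⟨q, hq⟩ : ∃ q : ℂ, q * q - z * q + 1 = 0 := by
    obtain ⟨d, hd⟩ := IsAlgClosed.exists_pow_nat_eq (z ^ 2 - 4) (n := 2) (by norm_num)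
    exact ⟨(z + d) / 2, by linear_combination hd / 4⟩
  refine ⟨⟨!![x, -1; 1, 0], by simp [Matrix.det_fin_two]⟩,
    ⟨!![0, z - q; -q, y], by rw [Matrix.det_fin_two]; simp; linear_combination -hq⟩, ?_, ?_, ?_⟩
  · simp [tr, Matrix.trace_fin_two]
  · simp [tr, Matrix.trace_fin_two]
  · change Matrix.trace (!![x, -1; 1, 0] * !![0, z - q; -q, y]) = z
    simp [Matrix.trace_fin_two]

/-- Each `w ∈ F(a, b)` has exactly one trace polynomial. -/
theorem existsUnique_tracePolynomial (w : FreeGroup (Fin 2)) :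
    ∃! f : MvPolynomial (Fin 3) ℤ, IsTracePolynomial w f := by
  obtain ⟨L, rfl⟩ := Quot.exists_rep w
  obtain ⟨p, q, r, s, h⟩ := exists_combination L
  refine existsUnique_of_exists_of_unique
    ⟨2 * p + MvPolynomial.X 0 * q + MvPolynomial.X 1 * r + MvPolynomial.X 2 * s, ?_⟩ ?_
  · intro A B
    have h1 := congrArg Matrix.trace (h A B)
    have h2 : Matrix.trace (A.1 * B.1) = tr (A * B) := by simp [tr]
    have h3 : Matrix.trace A.1 = tr A := rfl
    have h4 : Matrix.trace B.1 = tr B := rfl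
    simp only [Matrix.trace_add, Matrix.trace_smul, Matrix.trace_one, h2, h3, h4, smul_eq_mul,
      Fintype.card_fin] at h1
    refine h1.trans ?_
    simp only [map_add, map_mul, MvPolynomial.aeval_X, Matrix.cons_val, map_ofNat, Nat.cast_ofNat]
    ring
  · intro f g hf hg
    apply MvPolynomial.map_injective (Int.castRingHom ℂ) Int.cast_injective
    apply MvPolynomial.funext
    intro v
    obtain ⟨A, B, hA, hB, hAB⟩ := exists_traces (v 0) (v 1) (v 2)
    have hv : ![tr A, tr B, tr (A * B)] = v := by
      ext i
      fin_cases i <;> simp [hA, hB, hAB]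
    have h1 := (hf A B).symm.trans (hg A B)
    rw [hv] at h1
    simpa [MvPolynomial.eval_map, MvPolynomial.aeval_def] using h1

end Existence

/-- The Fricke trace polynomial `f_w ∈ ℤ[x, y, z]` of `w ∈ F(a, b)`: the unique polynomial with
`Tr w(A, B) = f_w(Tr A, Tr B, Tr AB)` for all `A, B ∈ SL(2, ℂ)`. -/
noncomputable def tracePolynomial (w : FreeGroup (Fin 2)) : MvPolynomial (Fin 3) ℤ :=
  (existsUnique_tracePolynomial w).choose

theorem tracePolynomial_spec (w : FreeGroup (Fin 2)) :
    IsTracePolynomial w (tracePolynomial w) :=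
  (existsUnique_tracePolynomial w).choose_spec.1

/-- The homogeneous part of a polynomial in its total degree. -/
noncomputable def topPart (f : MvPolynomial (Fin 3) ℤ) : MvPolynomial (Fin 3) ℤ :=
  MvPolynomial.homogeneousComponent f.totalDegree f

/-- `N_{rs}(u)`: the number of cyclic indices `i` with `u_i = r` and `u_{i+1} = s`.  The list
`u.zip (u.rotate 1)` consists of the pairs `(u_i, u_{i+1})`, with indices modulo the length. -/
def cyclicCount (r s : Letter) (u : List Letter) : ℕ := (u.zip (u.rotate 1)).count (r, s)

/-- The number of letters of `u` in `{a, a⁻¹}`. -/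
def countA (u : List Letter) : ℕ := u.countP (fun l => l.1 = 0)

/-- The number of letters of `u` in `{b, b⁻¹}`. -/
def countB (u : List Letter) : ℕ := u.countP (fun l => l.1 = 1)

/-- `R(u) = N_{ab}(u) + N_{b⁻¹a⁻¹}(u)`. -/
def R (u : List Letter) : ℕ := cyclicCount letA letB u + cyclicCount letBinv letAinv u

end Fricke

namespace Fricke

open Matrix

/-! Evaluate the defining identity on a family `A`, `B` that degenerates as `e → 0` while all three
traces grow like `e⁻²`, with prescribed nonzero leading coefficients `l, m, z`. To leading order,
`f_w` becomes `e ^ (-2 deg f_w)` times its top part at `(l, m, z)`.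

On the other side stands the trace of a product of letter matrices. Diagonal gauges inserted between
consecutive letters cancel around the cycle, and after a factor `e ^ stepOrder r s` each gauged
letter has a limit of rank one. The limiting trace is thus a product of scalars, one per cyclic pair
of letters. On reduced pairs each scalar is a nonzero monomial (it vanishes on cancelling pairs), so
the pole order is exactly the sum of the step orders. Comparing both sides
(`topPart_of_asymptotics`) gives the degree and the top part.

The step order is 2, except that it is 1 when the dominant diagonal corner switches. In a reduced
word this happens at `ab`, `b⁻¹a⁻¹` in one direction and at `ba`, `a⁻¹b⁻¹` in the other. Around a
cycle both directions occur `R` times, so `2 deg f_w = 2n - 2R`. The bounds follow from `2R ≤ m_a +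
m_b = n`. -/

theorem forall_letter {P : Letter → Prop} :
    (∀ r, P r) ↔ P letA ∧ P letAinv ∧ P letB ∧ P letBinv := by
  refine ⟨fun h => ⟨h _, h _, h _, h _⟩, fun ⟨h1, h2, h3, h4⟩ => ?_⟩
  rintro ⟨i, e⟩
  fin_cases i <;> cases e <;> assumption

/-! ### The degenerating family and its rank one limits -/

section LetterMatrices

variable (l m z e : ℂ)

/-- The matrices of a one-parameter family of pairs `(A, B)`, with traces `l / e ^ 2`, `m / e ^ 2`
and `z / e ^ 2` up to lower order terms as `e → 0`, and their inverses. -/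
noncomputable def letterMatrix : Letter → Matrix (Fin 2) (Fin 2) ℂ
  | (0, true) => !![l / e ^ 2, z / e; 0, e ^ 2 / l]
  | (0, false) => !![e ^ 2 / l, -(z / e); 0, l / e ^ 2]
  | (1, true) => !![e ^ 2 / m, 0; 1 / e, m / e ^ 2]
  | (1, false) => !![m / e ^ 2, 0; -(1 / e), e ^ 2 / m]

/-- Whether the dominant entry of the matrix of a letter is the upper left one. -/
def upper : Letter → Bool
  | (0, b) => b
  | (1, b) => !b

/-- The diagonal rescaling applied after a letter. -/
def gauge (r : Letter) : Matrix (Fin 2) (Fin 2) ℂ :=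
  if upper r then !![1, 0; 0, e] else !![e, 0; 0, 1]

/-- The order of the pole in `e` contributed by a letter `s` which follows a letter `r`. -/
def stepOrder (r s : Letter) : ℕ := if upper r = upper s then 2 else 1

/-- The matrix `e ^ stepOrder r s • gauge r * letterMatrix s * (gauge s)⁻¹`, extended to `e = 0`. -/
noncomputable def stepMatrix (r : Letter) : Letter → Matrix (Fin 2) (Fin 2) ℂ
  | (0, true) => if upper r then !![l, z; 0, e ^ 4 / l] else !![l, z; 0, e ^ 2 / l]
  | (0, false) => if upper r then !![e ^ 2 / l, -z; 0, l] else !![e ^ 4 / l, -(e ^ 2 * z); 0, l]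
  | (1, true) => if upper r then !![e ^ 2 / m, 0; 1, m] else !![e ^ 4 / m, 0; 1, m]
  | (1, false) => if upper r then !![m, 0; -e ^ 2, e ^ 4 / m] else !![m, 0; -1, e ^ 2 / m]

/-- The column factor of the rank one matrix `stepMatrix l m z 0 r s`. -/
def stepCol (r : Letter) : Letter → Fin 2 → ℂ
  | (0, true) => ![l, 0]
  | (0, false) => if upper r then ![-z, l] else ![0, l]
  | (1, true) => ![0, m]
  | (1, false) => if upper r then ![m, 0] else ![m, -1]

/-- The row factor of the rank one matrix `stepMatrix l m z 0 r s`. -/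
noncomputable def stepRow : Letter → Fin 2 → ℂ
  | (0, true) => ![1, z / l]
  | (0, false) => ![0, 1]
  | (1, true) => ![1 / m, 1]
  | (1, false) => ![1, 0]

/-- The factor contributed to the leading term of the trace by a letter `s` following `r`. -/
noncomputable def stepWeight (r s : Letter) : ℂ := stepRow l m z r ⬝ᵥ stepCol l m z r s

variable {l m z e}

theorem stepMatrix_mul_gauge (he : e ≠ 0) (r s : Letter) :
    stepMatrix l m z e r s * gauge e s =
      e ^ stepOrder r s • (gauge e r * letterMatrix l m z e s) := by
  revert r s
  simp only [forall_letter]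
  refine ⟨⟨?_, ?_, ?_, ?_⟩, ⟨?_, ?_, ?_, ?_⟩, ⟨?_, ?_, ?_, ?_⟩, ⟨?_, ?_, ?_, ?_⟩⟩ <;>
    simp [stepMatrix, gauge, stepOrder, letterMatrix, upper] <;> field_simp <;> simp

/-- All gauges have determinant `e`, so for `e ≠ 0` a step matrix has determinant `e ^ (2 *
stepOrder r s)`, which tends to 0. The row factor depends on `s` alone, so neighbouring factors in a
product meet in a scalar. -/
theorem stepMatrix_zero (hl : l ≠ 0) (hm : m ≠ 0) (r s : Letter) :
    stepMatrix l m z 0 r s = vecMulVec (stepCol l m z r s) (stepRow l m z s) := by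
  revert r s
  simp only [forall_letter]
  refine ⟨⟨?_, ?_, ?_, ?_⟩, ⟨?_, ?_, ?_, ?_⟩, ⟨?_, ?_, ?_, ?_⟩, ⟨?_, ?_, ?_, ?_⟩⟩ <;>
    · ext i j
      fin_cases i <;> fin_cases j <;>
        simp [stepMatrix, stepCol, stepRow, upper, vecMulVec_apply] <;> field_simp

theorem continuous_stepMatrix (r s : Letter) : Continuous fun e => stepMatrix l m z e r s := by
  revert r s
  simp only [forall_letter]
  refine ⟨⟨?_, ?_, ?_, ?_⟩, ⟨?_, ?_, ?_, ?_⟩, ⟨?_, ?_, ?_, ?_⟩, ⟨?_, ?_, ?_, ?_⟩⟩ <;>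
    · refine continuous_matrix fun i j => ?_
      fin_cases i <;> fin_cases j <;> simp [stepMatrix, upper] <;> fun_prop

/-- The product of the step matrices along a word telescopes. -/
theorem prod_stepMatrix_mul_gauge (he : e ≠ 0) (t : List Letter) (c d : Letter) :
    (((c :: t).zip (t ++ [d])).map fun p => stepMatrix l m z e p.1 p.2).prod * gauge e d =
      e ^ (((c :: t).zip (t ++ [d])).map fun p => stepOrder p.1 p.2).sum •
        (gauge e c * ((t ++ [d]).map (letterMatrix l m z e)).prod) := by
  induction t generalizing c with
  | nil => simpa using stepMatrix_mul_gauge he c d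
  | cons c' t ih =>
    simp only [List.cons_append, List.zip_cons_cons, List.map_cons, List.prod_cons, List.sum_cons,
      Matrix.mul_assoc] at ih ⊢
    rw [ih, mul_smul_comm, ← Matrix.mul_assoc, stepMatrix_mul_gauge he, pow_add, mul_smul,
      smul_mul_assoc, smul_comm, Matrix.mul_assoc]

/-- At `e = 0` the product of the step matrices along a word has rank one. -/
theorem prod_stepMatrix_zero (hl : l ≠ 0) (hm : m ≠ 0) (t : List Letter) (c d : Letter) :
    ∃ v : Fin 2 → ℂ,
      (((c :: t).zip (t ++ [d])).map fun p => stepMatrix l m z 0 p.1 p.2).prod =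
        vecMulVec v (stepRow l m z d) ∧
      stepRow l m z c ⬝ᵥ v =
        (((c :: t).zip (t ++ [d])).map fun p => stepWeight l m z p.1 p.2).prod := by
  induction t generalizing c with
  | nil => exact ⟨stepCol l m z c d, by simp [stepMatrix_zero hl hm], by simp [stepWeight]⟩
  | cons c' t ih =>
    obtain ⟨v, h1, h2⟩ := ih c'
    simp only [List.cons_append, List.zip_cons_cons, List.map_cons, List.prod_cons] at h1 h2 ⊢
    refine ⟨(stepRow l m z c' ⬝ᵥ v) • stepCol l m z c c', ?_, ?_⟩
    · rw [h1, stepMatrix_zero hl hm, vecMulVec_mul_vecMulVec]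
      simp [vecMulVec_smul, smul_vecMulVec]
    · rw [← h2, dotProduct_smul, smul_eq_mul, mul_comm, stepWeight]

end LetterMatrices

/-! ### Traces around a cyclic word -/

/-- The pairs of cyclically consecutive letters of a word. -/
def cyclicPairs (u : List Letter) : List (Letter × Letter) := u.zip (u.rotate 1)

theorem cyclicPairs_cons (c : Letter) (t : List Letter) :
    cyclicPairs (c :: t) = (c :: t).zip (t ++ [c]) := by simp [cyclicPairs]

theorem det_gauge_ne_zero {e : ℂ} (he : e ≠ 0) (r : Letter) : (gauge e r).det ≠ 0 := by
  unfold gauge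
  split_ifs <;> simpa [det_fin_two]

/-- The trace of the product of the step matrices around a cyclic word. -/
noncomputable def cyclicTrace (l m z e : ℂ) (u : List Letter) : ℂ :=
  Matrix.trace ((cyclicPairs u).map fun p => stepMatrix l m z e p.1 p.2).prod

theorem continuous_cyclicTrace (l m z : ℂ) (u : List Letter) :
    Continuous fun e => cyclicTrace l m z e u := by
  refine Continuous.matrix_trace (continuous_list_prod _ fun p _ => continuous_stepMatrix _ _)

theorem cyclicTrace_zero {l m z : ℂ} (hl : l ≠ 0) (hm : m ≠ 0) {u : List Letter} (hu : u ≠ []) :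
    cyclicTrace l m z 0 u = ((cyclicPairs u).map fun p => stepWeight l m z p.1 p.2).prod := by
  obtain ⟨c, t, rfl⟩ := List.exists_cons_of_ne_nil hu
  rw [cyclicTrace, cyclicPairs_cons]
  obtain ⟨v, h1, h2⟩ := prod_stepMatrix_zero (z := z) hl hm t c c
  rw [h1, ← h2, trace_vecMulVec, dotProduct_comm]

/-- The telescoped product begins and ends at the same letter, so the remaining gauge acts by
conjugation and drops out of the trace. The trace also absorbs the rotation of the word by one
letter. -/
theorem cyclicTrace_eq {l m z e : ℂ} (he : e ≠ 0) {u : List Letter} (hu : u ≠ []) :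
    cyclicTrace l m z e u = e ^ ((cyclicPairs u).map fun p => stepOrder p.1 p.2).sum *
      Matrix.trace (u.map (letterMatrix l m z e)).prod := by
  obtain ⟨c, t, rfl⟩ := List.exists_cons_of_ne_nil hu
  have h := prod_stepMatrix_mul_gauge (l := l) (m := m) (z := z) he t c c
  have hg : IsUnit (gauge e c).det := (det_gauge_ne_zero he c).isUnit
  rw [cyclicTrace, cyclicPairs_cons]
  rw [← Matrix.mul_nonsing_inv_cancel_right _ (List.prod _) hg, h, smul_mul_assoc, trace_smul, Matrix.mul_assoc,
    trace_mul_comm, Matrix.mul_assoc, Matrix.nonsing_inv_mul _ hg, Matrix.mul_one, smul_eq_mul]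
  rw [List.map_append, List.prod_append, trace_mul_comm]
  simp

/-- The leading order of `Tr w(A, B)` along the family of pairs given by `letterMatrix`. -/
theorem cyclicTrace_eq_aeval {l m z e : ℂ} (hl : l ≠ 0) (hm : m ≠ 0) (he : e ≠ 0)
    {u : List Letter} (hu : u ≠ []) :
    cyclicTrace l m z e u = e ^ ((cyclicPairs u).map fun p => stepOrder p.1 p.2).sum *
      MvPolynomial.aeval (fun i => (![l + e ^ 4 / l, m + e ^ 4 / m,
        z + e ^ 2 * (l / m + m / l)] : Fin 3 → ℂ) i / e ^ 2) (tracePolynomial (FreeGroup.mk u)) := by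
  let A : SL2C := ⟨letterMatrix l m z e letA, by
    simp only [letterMatrix, det_fin_two_of]; field_simp; ring⟩
  let B : SL2C := ⟨letterMatrix l m z e letB, by
    simp only [letterMatrix, det_fin_two_of]; field_simp; ring⟩
  have hword : (evalWord A B (FreeGroup.mk u)).1 = (u.map (letterMatrix l m z e)).prod := by
    have hlet : ∀ r : Letter, ((cond r.2 (![A, B] r.1) (![A, B] r.1)⁻¹ : SL2C) :
        Matrix (Fin 2) (Fin 2) ℂ) = letterMatrix l m z e r := by
      rw [forall_letter]
      refine ⟨rfl, ?_, rfl, ?_⟩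
      · refine (Matrix.SpecialLinearGroup.coe_inv A).trans ?_
        change adjugate (letterMatrix l m z e letA) = _
        simp [letterMatrix, adjugate_fin_two]
      · refine (Matrix.SpecialLinearGroup.coe_inv B).trans ?_
        change adjugate (letterMatrix l m z e letB) = _
        simp [letterMatrix, adjugate_fin_two]
    clear hu
    induction u with
    | nil => simp [evalWord, ← FreeGroup.one_eq_mk]
    | cons c t ih =>
      rw [List.map_cons, List.prod_cons, ← ih, ← hlet]
      simp [evalWord, FreeGroup.lift_mk]
  have hspec := tracePolynomial_spec (FreeGroup.mk u) A B
  rw [cyclicTrace_eq he hu, ← hword]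
  refine congrArg _ (hspec.trans ?_)
  congr 2
  ext i
  fin_cases i
  · simp [tr, A, letterMatrix, trace_fin_two]; field_simp
  · simp [tr, B, letterMatrix, trace_fin_two]; field_simp; ring
  · change Matrix.trace (letterMatrix l m z e letA * letterMatrix l m z e letB) =
      (z + e ^ 2 * (l / m + m / l)) / e ^ 2
    simp [letterMatrix, trace_fin_two]; field_simp; ring

end Fricke

/-! ### Reading off the top part from a pole -/

namespace Fricke

open MvPolynomial

theorem aeval_div_of_isHomogeneous {f : MvPolynomial (Fin 3) ℤ} {n : ℕ} (hf : f.IsHomogeneous n)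
    (v : Fin 3 → ℂ) {c : ℂ} (hc : c ≠ 0) :
    c ^ n * aeval (fun i => v i / c) f = aeval v f := by
  simp only [aeval_def, eval₂_eq', Finset.mul_sum]
  refine Finset.sum_congr rfl fun d hd => ?_
  have hn : n = ∑ i, d i := by
    rw [← hf (mem_support_iff.mp hd), Finsupp.weight_apply, Finsupp.sum_fintype] <;> simp
  simp only [div_pow, Finset.prod_div_distrib, Finset.prod_pow_eq_pow_sum, ← hn]
  field_simp

/-- Multiplying by `X 0 * X 1 * X 2` removes the restriction to points off the coordinate planes,
where the family is not controlled. -/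
theorem eq_zero_of_aeval_eq_zero {f : MvPolynomial (Fin 3) ℤ}
    (h : ∀ v : Fin 3 → ℂ, v 0 ≠ 0 → v 1 ≠ 0 → v 2 ≠ 0 → aeval v f = 0) : f = 0 := by
  have h0 : X 0 * X 1 * X 2 * f = 0 := by
    apply MvPolynomial.map_injective (Int.castRingHom ℂ) Int.cast_injective
    apply MvPolynomial.funext
    intro v
    have hv := h v
    simp only [aeval_def, algebraMap_int_eq] at hv
    simp only [map_mul, map_X, eval_X, eval_map, map_zero]
    by_cases h0 : v 0 = 0
    · simp [h0]
    by_cases h1 : v 1 = 0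
    · simp [h1]
    by_cases h2 : v 2 = 0
    · simp [h2]
    simp [hv h0 h1 h2]
  simpa [X_ne_zero] using h0

theorem topPart_ne_zero {f : MvPolynomial (Fin 3) ℤ} (hf : f ≠ 0) : topPart f ≠ 0 := by
  obtain ⟨d, hd, hdeg⟩ := Finset.exists_mem_eq_sup f.support (support_nonempty.mpr hf)
    fun s => s.sum fun _ k => k
  have hdeg' : d.degree = f.totalDegree := by
    rw [totalDegree, hdeg, Finsupp.degree_eq_sum, Finsupp.sum_fintype _ _ fun _ => rfl]
  intro h
  have := congrArg (coeff d) h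
  rw [topPart, coeff_homogeneousComponent, if_pos hdeg', coeff_zero] at this
  exact mem_support_iff.mp hd this

/-- The numerator of `f (v / e ^ 2)`. -/
noncomputable def clearedEval (f : MvPolynomial (Fin 3) ℤ) (v : Fin 3 → ℂ) (e : ℂ) : ℂ :=
  ∑ k ∈ Finset.range (f.totalDegree + 1),
    (e ^ 2) ^ (f.totalDegree - k) * aeval v (homogeneousComponent k f)

theorem clearedEval_zero (f : MvPolynomial (Fin 3) ℤ) (v : Fin 3 → ℂ) :
    clearedEval f v 0 = aeval v (topPart f) := by
  rw [clearedEval, Finset.sum_range_succ, Finset.sum_eq_zero]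
  · simp [topPart]
  · intro k hk
    have := Finset.mem_range.mp hk
    rw [zero_pow two_ne_zero, zero_pow (by lia), zero_mul]

theorem clearedEval_eq (f : MvPolynomial (Fin 3) ℤ) (v : Fin 3 → ℂ) {e : ℂ} (he : e ≠ 0) :
    clearedEval f v e = e ^ (2 * f.totalDegree) * aeval (fun i => v i / e ^ 2) f := by
  conv_rhs => rw [← sum_homogeneousComponent f]
  rw [map_sum, Finset.mul_sum, clearedEval]
  refine Finset.sum_congr rfl fun k hk => ?_
  have hk' := Finset.mem_range.mp hk
  rw [← aeval_div_of_isHomogeneous (homogeneousComponent_isHomogeneous k f) v (pow_ne_zero 2 he),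
    ← mul_assoc, ← pow_add, pow_mul, sum_homogeneousComponent, Nat.sub_add_cancel (by lia)]

theorem continuous_clearedEval (f : MvPolynomial (Fin 3) ℤ) {v : ℂ → Fin 3 → ℂ}
    (hv : Continuous v) : Continuous fun e => clearedEval f (v e) e := by
  have : ∀ g : MvPolynomial (Fin 3) ℤ, Continuous fun e => aeval (v e) g := by
    intro g
    simp only [aeval_def, eval₂_eq']
    fun_prop
  unfold clearedEval
  fun_prop

/-- After cancelling `e ^ p`, the two continuous sides agree on the dense punctured plane, hence at
0. -/
theorem eq_of_pow_mul_eq {F G : ℂ → ℂ} (hF : Continuous F) (hG : Continuous G) {p q : ℕ}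
    (h : ∀ e, e ≠ 0 → e ^ p * F e = e ^ q * G e) (hpq : p ≤ q) :
    F 0 = 0 ^ (q - p) * G 0 := by
  have heq : Set.EqOn F (fun e => e ^ (q - p) * G e) {0}ᶜ := by
    intro e he
    apply mul_left_cancel₀ (pow_ne_zero p he)
    rw [h e he, ← mul_assoc, ← pow_add, Nat.add_sub_cancel' hpq]
  exact congrFun (Continuous.ext_on (dense_compl_singleton 0) hF (by fun_prop) heq) 0

/-- If `f (v / e ^ 2)` has, for all `v` in a family parametrised by its nonvanishing value
at `e = 0`, a pole of order `N` at `e = 0`, then `N = 2 * deg f`, and the leading coefficients are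
the values of the top part of `f`. -/
theorem topPart_of_asymptotics {f : MvPolynomial (Fin 3) ℤ} {N : ℕ} {v F : (Fin 3 → ℂ) → ℂ → _}
    (hv : ∀ a, Continuous (v a)) (hv0 : ∀ a, v a 0 = a) (hF : ∀ a, Continuous (F a))
    (hF0 : ∀ a : Fin 3 → ℂ, a 0 ≠ 0 → a 1 ≠ 0 → a 2 ≠ 0 → F a 0 ≠ 0)
    (h : ∀ a : Fin 3 → ℂ, a 0 ≠ 0 → a 1 ≠ 0 → a 2 ≠ 0 → ∀ e, e ≠ 0 →
      F a e = e ^ N * aeval (fun i => v a e i / e ^ 2) f) :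
    2 * f.totalDegree = N ∧ ∀ a : Fin 3 → ℂ, a 0 ≠ 0 → a 1 ≠ 0 → a 2 ≠ 0 →
      aeval a (topPart f) = F a 0 := by
  have key : ∀ a : Fin 3 → ℂ, a 0 ≠ 0 → a 1 ≠ 0 → a 2 ≠ 0 → ∀ e, e ≠ 0 →
      e ^ (2 * f.totalDegree) * F a e = e ^ N * clearedEval f (v a e) e := by
    intro a h0 h1 h2 e he
    rw [h a h0 h1 h2 e he, clearedEval_eq f _ he]
    ring
  have hG0 : ∀ a, clearedEval f (v a 0) 0 = aeval a (topPart f) := by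
    intro a
    rw [clearedEval_zero, hv0]
  have hle : N ≤ 2 * f.totalDegree := by
    by_contra! hlt
    have := eq_of_pow_mul_eq (hF 1) (continuous_clearedEval f (hv 1)) (key 1 (by simp) (by simp)
      (by simp)) hlt.le
    rw [zero_pow (by lia), zero_mul] at this
    exact hF0 1 (by simp) (by simp) (by simp) this
  have htop : ∀ a : Fin 3 → ℂ, a 0 ≠ 0 → a 1 ≠ 0 → a 2 ≠ 0 →
      aeval a (topPart f) = 0 ^ (2 * f.totalDegree - N) * F a 0 := by
    intro a h0 h1 h2
    rw [← hG0]
    exact eq_of_pow_mul_eq (continuous_clearedEval f (hv a)) (hF a)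
      (fun e he => (key a h0 h1 h2 e he).symm) hle
  have heq : 2 * f.totalDegree = N := by
    by_contra hne
    -- A strict inequality would make the top part vanish off the coordinate planes. Only `f = 0`
    -- allows that, and then `totalDegree` is 0, which forces `N = 0` too.
    have hf : f = 0 := by
      by_contra hf
      refine topPart_ne_zero hf (eq_zero_of_aeval_eq_zero fun a h0 h1 h2 => ?_)
      rw [htop a h0 h1 h2, zero_pow (by lia), zero_mul]
    simp [hf] at hne hle
    lia
  refine ⟨heq, fun a h0 h1 h2 => ?_⟩
  rw [htop a h0 h1 h2, heq, Nat.sub_self, pow_zero, one_mul]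

end Fricke

/-! ### Counting pairs in cyclically reduced words -/

namespace Fricke

/-- No cancellation between consecutive letters. -/
def ReducedPair (p : Letter × Letter) : Prop := p.1.1 = p.2.1 → p.1.2 = p.2.2

theorem reducedPair_of_isReduced (t : List Letter) (c d : Letter)
    (h : FreeGroup.IsReduced (c :: (t ++ [d]))) :
    ∀ p ∈ (c :: t).zip (t ++ [d]), ReducedPair p := by
  induction t generalizing c with
  | nil => simpa [ReducedPair, FreeGroup.IsReduced] using h
  | cons c' t ih =>
    simp only [FreeGroup.IsReduced, List.cons_append, List.isChain_cons_cons] at h ih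
    simp only [List.cons_append, List.zip_cons_cons, List.forall_mem_cons]
    exact ⟨h.1, ih c' h.2⟩

theorem reducedPair_cyclicPairs {u : List Letter} (h : FreeGroup.IsCyclicallyReduced u) :
    ∀ p ∈ cyclicPairs u, ReducedPair p := by
  cases u with
  | nil => simp [cyclicPairs]
  | cons c t =>
    rw [cyclicPairs_cons]
    -- Repeating the first letter at the end turns cyclic reducedness into ordinary reducedness.
    refine reducedPair_of_isReduced t c c ?_
    obtain ⟨h1, h2⟩ := h
    rw [← List.cons_append, FreeGroup.IsReduced, List.isChain_append]
    exact ⟨h1, by simp, by simpa using h2⟩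

theorem map_fst_cyclicPairs (u : List Letter) : (cyclicPairs u).map Prod.fst = u :=
  List.map_fst_zip (by simp)

theorem map_snd_cyclicPairs (u : List Letter) : (cyclicPairs u).map Prod.snd = u.rotate 1 :=
  List.map_snd_zip (by simp)

theorem length_cyclicPairs (u : List Letter) : (cyclicPairs u).length = u.length := by
  simp [cyclicPairs]

theorem countP_snd_cyclicPairs (P : Letter → Bool) (u : List Letter) :
    (cyclicPairs u).countP (fun p => P p.2) = u.countP P := by
  rw [← (List.rotate_perm u 1).countP_eq P, ← map_snd_cyclicPairs, List.countP_map]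
  rfl

theorem countP_fst_cyclicPairs (P : Letter → Bool) (u : List Letter) :
    (cyclicPairs u).countP (fun p => P p.1) = u.countP P := by
  conv_rhs => rw [← map_fst_cyclicPairs u, List.countP_map]
  rfl

section PairLists

variable {L : List (Letter × Letter)}

@[elab_as_elim]
theorem reducedPair_induction {P : List (Letter × Letter) → Prop} (nil : P [])
    (cons : ∀ r s L, ReducedPair (r, s) → P L → P ((r, s) :: L))
    (h : ∀ p ∈ L, ReducedPair p) : P L := by
  induction L with
  | nil => exact nil
  | cons p L ih =>
    exact cons p.1 p.2 L (h p (by simp)) (ih fun q hq => h q (by simp [hq]))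

theorem sum_stepOrder (h : ∀ p ∈ L, ReducedPair p) :
    (L.map fun p => stepOrder p.1 p.2).sum + (L.count (letA, letB) + L.count (letB, letA)
      + L.count (letAinv, letBinv) + L.count (letBinv, letAinv)) = 2 * L.length := by
  refine reducedPair_induction ?_ ?_ h
  · simp
  intro r s L hrs ih
  have : stepOrder r s + ((if (r, s) = (letA, letB) then 1 else 0)
      + (if (r, s) = (letB, letA) then 1 else 0) + (if (r, s) = (letAinv, letBinv) then 1 else 0)
      + (if (r, s) = (letBinv, letAinv) then 1 else 0)) = 2 := by
    revert r s
    simp [ReducedPair, stepOrder, upper]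
  simp only [List.map_cons, List.sum_cons, List.count_cons, beq_iff_eq, List.length_cons]
  lia

/-- The pairs counted on the left leave the class `upper`, those on the right enter it. For a cyclic
word the two `countP` terms agree and cancel. -/
theorem count_balance (h : ∀ p ∈ L, ReducedPair p) :
    L.count (letA, letB) + L.count (letBinv, letAinv) + L.countP (fun p => upper p.2) =
      L.count (letB, letA) + L.count (letAinv, letBinv) + L.countP (fun p => upper p.1) := by
  refine reducedPair_induction ?_ ?_ h
  · simp
  intro r s L hrs ih
  have : (if (r, s) = (letA, letB) then 1 else 0) + (if (r, s) = (letBinv, letAinv) then 1 else 0)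
      + (if upper s then 1 else 0) = (if (r, s) = (letB, letA) then 1 else 0)
      + (if (r, s) = (letAinv, letBinv) then 1 else 0) + (if upper r then 1 else 0) := by
    revert r s
    simp [ReducedPair, upper]
  simp only [List.count_cons, List.countP_cons, beq_iff_eq]
  lia

/-- A step to `s` generically weighs `l` or `m` according to its generator. The four switching pairs
weigh instead `z * m / l` for `ab`, `l / m` for `ba`, `-1` for `a⁻¹b⁻¹` and `-z` for `b⁻¹a⁻¹`.
Denominators are moved to the left side. -/
theorem prod_stepWeight {l m : ℂ} (z : ℂ) (hl : l ≠ 0) (hm : m ≠ 0)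
    (h : ∀ p ∈ L, ReducedPair p) :
    (L.map fun p => stepWeight l m z p.1 p.2).prod
        * l ^ (L.count (letA, letB) + L.count (letBinv, letAinv))
        * m ^ (L.count (letB, letA) + L.count (letAinv, letBinv)) =
      (-1) ^ (L.count (letAinv, letBinv) + L.count (letBinv, letAinv))
        * l ^ L.countP (fun p => p.2.1 = 0) * m ^ L.countP (fun p => p.2.1 = 1)
        * z ^ (L.count (letA, letB) + L.count (letBinv, letAinv)) := by
  refine reducedPair_induction ?_ ?_ h
  · simp
  intro r s L hrs ih
  have : stepWeight l m z r s
      * l ^ ((if (r, s) = (letA, letB) then 1 else 0)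
        + (if (r, s) = (letBinv, letAinv) then 1 else 0))
      * m ^ ((if (r, s) = (letB, letA) then 1 else 0)
        + (if (r, s) = (letAinv, letBinv) then 1 else 0)) =
      (-1) ^ ((if (r, s) = (letAinv, letBinv) then 1 else 0)
        + (if (r, s) = (letBinv, letAinv) then 1 else 0))
      * l ^ (if s.1 = 0 then 1 else 0) * m ^ (if s.1 = 1 then 1 else 0)
      * z ^ ((if (r, s) = (letA, letB) then 1 else 0)
        + (if (r, s) = (letBinv, letAinv) then 1 else 0)) := by
    revert r s
    simp [ReducedPair, upper, stepWeight, stepRow, stepCol]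
    field_simp
    simp
  simp only [List.map_cons, List.prod_cons, List.count_cons, List.countP_cons, beq_iff_eq,
    decide_eq_true_eq, pow_add] at ih this ⊢
  linear_combination congrArg₂ (· * ·) ih this

theorem count_le_countP_fst :
    L.count (letA, letB) ≤ L.countP (fun p => p.1 = letA) ∧
    L.count (letBinv, letAinv) ≤ L.countP (fun p => p.1 = letBinv) := by
  constructor <;> exact List.countP_mono_left (by simp +contextual)

theorem count_le_countP_snd :
    L.count (letA, letB) ≤ L.countP (fun p => p.2 = letB) ∧
    L.count (letBinv, letAinv) ≤ L.countP (fun p => p.2 = letAinv) := by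
  constructor <;> exact List.countP_mono_left (by simp +contextual)

end PairLists

theorem countA_eq (u : List Letter) :
    countA u = u.countP (· = letA) + u.countP (· = letAinv) := by
  unfold countA
  induction u with
  | nil => rfl
  | cons r u ih =>
    have : (if r.1 = 0 then 1 else 0) = (if r = letA then 1 else 0)
        + (if r = letAinv then 1 else 0) := by
      revert r; simp
    simp only [List.countP_cons, decide_eq_true_eq]
    lia

theorem countB_eq (u : List Letter) :
    countB u = u.countP (· = letB) + u.countP (· = letBinv) := by
  unfold countB
  induction u with
  | nil => rfl
  | cons r u ih =>
    have : (if r.1 = 1 then 1 else 0) = (if r = letB then 1 else 0)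
        + (if r = letBinv then 1 else 0) := by
      revert r; simp
    simp only [List.countP_cons, decide_eq_true_eq]
    lia

theorem countA_add_countB (u : List Letter) : countA u + countB u = u.length := by
  unfold countA countB
  induction u with
  | nil => rfl
  | cons r u ih =>
    have : (if r.1 = 0 then 1 else 0) + (if r.1 = 1 then 1 else 0) = 1 := by
      revert r; simp
    simp only [List.countP_cons, decide_eq_true_eq, List.length_cons]
    lia

/-- Charge each `ab` to its `a` and each `b⁻¹a⁻¹` to its `a⁻¹`; no letter is charged twice. -/
theorem R_le_countA (u : List Letter) : R u ≤ countA u := by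
  have h1 := (count_le_countP_fst (L := cyclicPairs u)).1
  have h2 := (count_le_countP_snd (L := cyclicPairs u)).2
  rw [countP_fst_cyclicPairs (· = letA)] at h1
  rw [countP_snd_cyclicPairs (· = letAinv)] at h2
  rw [countA_eq]
  exact Nat.add_le_add h1 h2

theorem R_le_countB (u : List Letter) : R u ≤ countB u := by
  have h1 := (count_le_countP_snd (L := cyclicPairs u)).1
  have h2 := (count_le_countP_fst (L := cyclicPairs u)).2
  rw [countP_snd_cyclicPairs (· = letB)] at h1
  rw [countP_fst_cyclicPairs (· = letBinv)] at h2
  rw [countB_eq]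
  exact Nat.add_le_add h1 h2

theorem R_eq {u : List Letter} (h : FreeGroup.IsCyclicallyReduced u) :
    R u = cyclicCount letB letA u + cyclicCount letAinv letBinv u := by
  have := count_balance (reducedPair_cyclicPairs h)
  rw [countP_fst_cyclicPairs, countP_snd_cyclicPairs] at this
  exact Nat.add_right_cancel this

section TopPart

variable {u : List Letter}

theorem prod_stepWeight_cyclicPairs (hu : FreeGroup.IsCyclicallyReduced u) {l m : ℂ} (z : ℂ)
    (hl : l ≠ 0) (hm : m ≠ 0) :
    ((cyclicPairs u).map fun p => stepWeight l m z p.1 p.2).prod =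
      (-1) ^ (cyclicCount letA letB u + cyclicCount letB letA u)
        * l ^ (countA u - R u) * m ^ (countB u - R u) * z ^ R u := by
  have h := prod_stepWeight z hl hm (reducedPair_cyclicPairs hu)
  rw [countP_snd_cyclicPairs (fun r => r.1 = 0), countP_snd_cyclicPairs (fun r => r.1 = 1)] at h
  change _ * l ^ R u * m ^ (cyclicCount letB letA u + cyclicCount letAinv letBinv u) =
    (-1) ^ (cyclicCount letAinv letBinv u + cyclicCount letBinv letAinv u)
      * l ^ countA u * m ^ countB u * z ^ R u at h
  -- The two expressions for `R` give `N_ab - N_ba = N_{a⁻¹b⁻¹} - N_{b⁻¹a⁻¹}`, so the exponents have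
  -- equal parity.
  have hsign : (-1 : ℂ) ^ (cyclicCount letAinv letBinv u + cyclicCount letBinv letAinv u) =
      (-1) ^ (cyclicCount letA letB u + cyclicCount letB letA u) := by
    apply neg_one_pow_congr
    have hR := R_eq hu
    unfold R at hR
    grind
  rw [← R_eq hu, hsign, ← Nat.sub_add_cancel (R_le_countA u),
    ← Nat.sub_add_cancel (R_le_countB u), pow_add, pow_add] at h
  apply mul_right_cancel₀ (mul_ne_zero (pow_ne_zero (R u) hl) (pow_ne_zero (R u) hm))
  linear_combination h

theorem totalDegree_and_topPart (hne : u ≠ []) (hu : FreeGroup.IsCyclicallyReduced u) :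
    (tracePolynomial (FreeGroup.mk u)).totalDegree + R u = u.length ∧
    topPart (tracePolynomial (FreeGroup.mk u)) =
      (-1) ^ (cyclicCount letA letB u + cyclicCount letB letA u)
        * MvPolynomial.X 0 ^ (countA u - R u) * MvPolynomial.X 1 ^ (countB u - R u)
        * MvPolynomial.X 2 ^ R u := by
  have hval : ∀ a : Fin 3 → ℂ, a 0 ≠ 0 → a 1 ≠ 0 → cyclicTrace (a 0) (a 1) (a 2) 0 u =
      (-1) ^ (cyclicCount letA letB u + cyclicCount letB letA u)
        * a 0 ^ (countA u - R u) * a 1 ^ (countB u - R u) * a 2 ^ R u := fun a h0 h1 => by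
    rw [cyclicTrace_zero h0 h1 hne, prod_stepWeight_cyclicPairs hu _ h0 h1]
  obtain ⟨hdeg, htop⟩ := topPart_of_asymptotics (f := tracePolynomial (FreeGroup.mk u))
    (v := fun a e => ![a 0 + e ^ 4 / a 0, a 1 + e ^ 4 / a 1,
      a 2 + e ^ 2 * (a 0 / a 1 + a 1 / a 0)])
    (F := fun a e => cyclicTrace (a 0) (a 1) (a 2) e u)
    (fun a => by
      refine continuous_pi fun i => ?_
      fin_cases i <;> simp <;> fun_prop)
    (fun a => by ext i; fin_cases i <;> simp)
    (fun a => continuous_cyclicTrace _ _ _ u)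
    (fun a h0 h1 h2 => by simp [hval a h0 h1, h0, h1, h2])
    (fun a h0 h1 _ e he => cyclicTrace_eq_aeval h0 h1 he hne)
  constructor
  · have h := sum_stepOrder (reducedPair_cyclicPairs hu)
    rw [← hdeg, length_cyclicPairs] at h
    change _ + (cyclicCount letA letB u + cyclicCount letB letA u + cyclicCount letAinv letBinv u
      + cyclicCount letBinv letAinv u) = _ at h
    have hR := R_eq hu
    unfold R at hR ⊢
    lia
  · rw [← sub_eq_zero]
    refine eq_zero_of_aeval_eq_zero fun a h0 h1 h2 => ?_
    rw [map_sub, htop a h0 h1 h2, hval a h0 h1, sub_eq_zero]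
    simp

end TopPart

/-! ### Extremal words -/

theorem isCyclicallyReduced_of_positive {u : List Letter} (h : ∀ r ∈ u, r.2 = true) :
    FreeGroup.IsCyclicallyReduced u := by
  refine ⟨List.Pairwise.isChain (List.pairwise_iff_forall_sublist.mpr ?_), ?_⟩
  · intro r s hrs _
    rw [h r (hrs.subset (by simp)), h s (hrs.subset (by simp))]
  · intro r hr s hs _
    rw [h r (List.mem_of_getLast? hr), h s (List.mem_of_head? hs)]

/-- The alternating word `abab⋯` of a given length. -/
def alternatingWord : ℕ → List Letter
  | 0 => []
  | 1 => [letA]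
  | n + 2 => letA :: letB :: alternatingWord n

theorem length_alternatingWord : ∀ n, (alternatingWord n).length = n
  | 0 => rfl
  | 1 => rfl
  | n + 2 => by simp [alternatingWord, length_alternatingWord n]

theorem alternatingWord_positive : ∀ n, ∀ r ∈ alternatingWord n, r.2 = true
  | 0 => by simp [alternatingWord]
  | 1 => by simp [alternatingWord]
  | n + 2 => by simpa [alternatingWord] using alternatingWord_positive n

/-- A nonempty alternating word starts with `a`, so prepending `ab` leaves the wrap-around pair
unchanged. For odd length that pair is `aa`. -/
theorem cyclicPairs_alternatingWord (n : ℕ) :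
    cyclicPairs (alternatingWord (n + 2)) =
      (letA, letB) :: (letB, letA) :: cyclicPairs (alternatingWord n) := by
  match n with
  | 0 => rfl
  | 1 => rfl
  | n + 2 => simp [alternatingWord, cyclicPairs]

theorem R_alternatingWord : ∀ n, R (alternatingWord n) = n / 2
  | 0 => rfl
  | 1 => by decide
  | n + 2 => by
    have ih := R_alternatingWord n
    simp only [R, cyclicCount] at ih ⊢
    change List.count _ (cyclicPairs _) + List.count _ (cyclicPairs _) = _ at ih
    change List.count _ (cyclicPairs _) + List.count _ (cyclicPairs _) = _
    rw [cyclicPairs_alternatingWord]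
    simp at ih ⊢
    lia

theorem R_replicate (n : ℕ) : R (List.replicate n letA) = 0 := by
  have := R_le_countB (List.replicate n letA)
  simpa [countB, List.countP_replicate] using this

theorem natCeil_half (n : ℕ) : ⌈(n : ℚ) / 2⌉₊ = n - n / 2 := by
  apply le_antisymm
  · have h : (n : ℚ) ≤ 2 * (n - n / 2 : ℕ) := by
      have : n ≤ 2 * (n - n / 2) := by lia
      exact_mod_cast this
    rw [Nat.ceil_le]
    linarith
  · have h := Nat.le_ceil ((n : ℚ) / 2)
    have : n ≤ 2 * ⌈(n : ℚ) / 2⌉₊ := by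
      rw [div_le_iff₀ two_pos] at h
      rw [mul_comm]
      exact_mod_cast h
    lia

end Fricke

theorem theorem1p1 :
    (∀ u : List Fricke.Letter, u ≠ [] → FreeGroup.IsCyclicallyReduced u →
      (Fricke.R u ≤ Fricke.countA u ∧ Fricke.R u ≤ Fricke.countB u ∧
        Fricke.topPart (Fricke.tracePolynomial (FreeGroup.mk u)) =
          (-1) ^ (Fricke.cyclicCount Fricke.letA Fricke.letB u
              + Fricke.cyclicCount Fricke.letB Fricke.letA u)
            * MvPolynomial.X 0 ^ (Fricke.countA u - Fricke.R u)
            * MvPolynomial.X 1 ^ (Fricke.countB u - Fricke.R u)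
            * MvPolynomial.X 2 ^ Fricke.R u) ∧
      (((Fricke.tracePolynomial (FreeGroup.mk u)).totalDegree : ℤ)
          = (u.length : ℤ) - (Fricke.R u : ℤ)) ∧
      (((Fricke.tracePolynomial (FreeGroup.mk u)).totalDegree : ℚ)
          = (u.length : ℚ) - 1 / 2 *
            ((Fricke.cyclicCount Fricke.letA Fricke.letB u : ℚ)
              + (Fricke.cyclicCount Fricke.letB Fricke.letA u : ℚ)
              + (Fricke.cyclicCount Fricke.letAinv Fricke.letBinv u : ℚ)
              + (Fricke.cyclicCount Fricke.letBinv Fricke.letAinv u : ℚ))) ∧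
      ⌈(u.length : ℚ) / 2⌉₊ ≤ (Fricke.tracePolynomial (FreeGroup.mk u)).totalDegree ∧
      (Fricke.tracePolynomial (FreeGroup.mk u)).totalDegree ≤ u.length) ∧
    (∀ n : ℕ, 1 ≤ n →
      (∃ u : List Fricke.Letter, u.length = n ∧ FreeGroup.IsCyclicallyReduced u ∧
        (Fricke.tracePolynomial (FreeGroup.mk u)).totalDegree = ⌈(n : ℚ) / 2⌉₊) ∧
      (∃ u : List Fricke.Letter, u.length = n ∧ FreeGroup.IsCyclicallyReduced u ∧
        (Fricke.tracePolynomial (FreeGroup.mk u)).totalDegree = n)) := by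
  refine ⟨fun u hne hu => ?_, fun n hn => ⟨?_, ?_⟩⟩
  · obtain ⟨hdeg, htop⟩ := Fricke.totalDegree_and_topPart hne hu
    have hA := Fricke.R_le_countA u
    have hB := Fricke.R_le_countB u
    have hlen := Fricke.countA_add_countB u
    refine ⟨⟨hA, hB, htop⟩, by lia, ?_, ?_, by lia⟩
    · have hR := Fricke.R_eq hu
      have hR' : Fricke.R u = Fricke.cyclicCount Fricke.letA Fricke.letB u
        + Fricke.cyclicCount Fricke.letBinv Fricke.letAinv u := rfl
      have h1 : ((Fricke.tracePolynomial (FreeGroup.mk u)).totalDegree : ℚ) + Fricke.R u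
        = u.length := by exact_mod_cast hdeg
      have h2 : (Fricke.R u : ℚ) = Fricke.cyclicCount Fricke.letB Fricke.letA u
        + Fricke.cyclicCount Fricke.letAinv Fricke.letBinv u := by exact_mod_cast hR
      have h3 : (Fricke.R u : ℚ) = Fricke.cyclicCount Fricke.letA Fricke.letB u
        + Fricke.cyclicCount Fricke.letBinv Fricke.letAinv u := by exact_mod_cast hR'
      linarith
    -- `R` is at most both letter counts, which add up to the length, so `2R ≤ n`.
    · rw [Fricke.natCeil_half]
      lia
  · have hlen := Fricke.length_alternatingWord n
    have hred := Fricke.isCyclicallyReduced_of_positive (Fricke.alternatingWord_positive n)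
    have hne : Fricke.alternatingWord n ≠ [] := by
      rintro h
      simp [h] at hlen
      lia
    refine ⟨_, hlen, hred, ?_⟩
    have hdeg := (Fricke.totalDegree_and_topPart hne hred).1
    rw [Fricke.R_alternatingWord, hlen] at hdeg
    rw [Fricke.natCeil_half]
    lia
  · have hred : FreeGroup.IsCyclicallyReduced (List.replicate n Fricke.letA) :=
      Fricke.isCyclicallyReduced_of_positive fun r hr => by rw [List.eq_of_mem_replicate hr]
    have hne : List.replicate n Fricke.letA ≠ [] := by
      rw [Ne, List.replicate_eq_nil_iff]
      lia
    refine ⟨_, List.length_replicate, hred, ?_⟩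
    simpa [Fricke.R_replicate] using (Fricke.totalDegree_and_topPart hne hred).1
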